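/- **Setting.** Let $U_{[1]},U_{[2]}\in\mathrm{SU}(2)$ be independent and distributed according to the Haar probability measure, and let $t\in\{1,2\}$ be uniformly distributed. Three single-qubit gates are available: a sample of each candidate, implementing $U_{[1]}$ and $U_{[2]}$, and a target gate implementing $U_{[t]}$. Each is used once. A discrimination protocol $\mathcal P$ does not depend on $U_{[1]},U_{[2]},t$; all its systems are finite-dimensional, and all measurement outcomes are natural numbers, except that the final guess is in $\{1,2\}$. It proceeds as follows. 1. Prepare, with probability $p^{(r_1)}$, a state labelled by $r_1$ of a qubit together with a finite-dimensional system. 2. Apply one of the three gates, chosen depending on $r_1$, to the qubit. 3. Apply a quantum instrument (a family of completely positive maps whose sum is trace preserving), chosen depending on $r_1$, with outcome $r_2$; its output is again a qubit together with a finite-dimensional system. 4. Apply one of the two remaining gates, chosen depending on $(r_1,r_2)$, to the qubit. 5. Apply a quantum instrument, chosen depending on $(r_1,r_2)$, with outcome $r_3$; its output is again a qubit together with a finite-dimensional system. 6. Apply the last remaining gate to the qubit. 7. Perform on the whole system a two-outcome measurement (POVM), chosen depending on $(r_1,r_2,r_3)$; its outcome $g\in\{1,2\}$ is the guess for $t$.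 Let $p_{\mathrm{suc}}(U_{[1]},U_{[2]},t,\mathcal P)$ be the probability that $g=t$, and $$\mathrm{ESP}(\mathcal P)=\frac12\sum_{t=1,2}\int\!\!\int p_{\mathrm{suc}}(U_{[1]},U_{[2]},t,\mathcal P)\,dU_{[1]}\,dU_{[2]},$$ with the integrals over the Haar probability measure of $\mathrm{SU}(2)$. **Theorem.** The maximum of $\mathrm{ESP}(\mathcal P)$ over all such protocols $\mathcal P$ is $\frac78$. Moreover, it is attained by a protocol that needs only one of the two samples: for one of the candidates, replacing the unitary implemented by its sample by any other one never changes the probabilities of the guesses. -/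

import Mathlib

open MeasureTheory
open scoped Matrix Kronecker ENNReal ComplexOrder

noncomputable section

namespace GateDiscrimination

/-! ### The group `SU(2)` and its Haar probability measure -/

/-- The group of `2 × 2` special unitary matrices. -/
abbrev SU2 : Type := Matrix.specialUnitaryGroup (Fin 2) ℂ

instance : ContinuousInv SU2 where
  continuous_inv :=
    Continuous.subtype_mk (f := fun A : SU2 => star (A : Matrix (Fin 2) (Fin 2) ℂ))
      (continuous_subtype_val.star) _

instance : IsTopologicalGroup SU2 where

instance : CompactSpace SU2 := by
  have hc : IsClosed
      ((Matrix.specialUnitaryGroup (Fin 2) ℂ : Submonoid (Matrix (Fin 2) (Fin 2) ℂ)) :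
        Set (Matrix (Fin 2) (Fin 2) ℂ)) := by
    have : ((Matrix.specialUnitaryGroup (Fin 2) ℂ : Submonoid (Matrix (Fin 2) (Fin 2) ℂ)) :
        Set (Matrix (Fin 2) (Fin 2) ℂ)) = {A | A * star A = 1} ∩ {A | A.det = 1} := by
      ext A
      simp [Matrix.mem_specialUnitaryGroup_iff, Matrix.mem_unitaryGroup_iff]
    rw [this]
    exact (isClosed_eq (continuous_id.mul continuous_id.star) continuous_const).inter
      (isClosed_eq continuous_id.matrix_det continuous_const)
  have hb : IsCompact (Set.pi Set.univ fun _ : Fin 2 => Set.pi Set.univ fun _ : Fin 2 =>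
      Metric.closedBall (0 : ℂ) 1) :=
    isCompact_univ_pi fun _ => isCompact_univ_pi fun _ => isCompact_closedBall _ _
  refine isCompact_iff_compactSpace.mp (hb.of_isClosed_subset hc ?_)
  intro A hA i _ j _
  simpa using entry_norm_bound_of_unitary (Matrix.mem_specialUnitaryGroup_iff.mp hA).1 i j

instance : MeasurableSpace SU2 := borel SU2

instance : BorelSpace SU2 := ⟨rfl⟩

/-- The Haar measure of `SU(2)`, normalized to total mass `1`. -/
def haarSU2 : Measure SU2 := Measure.haarMeasure ⊤

instance : haarSU2.IsHaarMeasure := Measure.isHaarMeasure_haarMeasure _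

instance : IsProbabilityMeasure haarSU2 := ⟨Measure.haarMeasure_self⟩

/-! ### Quantum operations -/

/-- Complete positivity of a linear map `Φ` between matrix algebras: for every `k`, the map
`id_k ⊗ Φ` sends positive semidefinite matrices to positive semidefinite matrices. -/
def IsCompletelyPositive {m n : Type} [Fintype m] [Fintype n]
    (Φ : Matrix m m ℂ →ₗ[ℂ] Matrix n n ℂ) : Prop :=
  ∀ (k : ℕ) (X : Matrix (Fin k × m) (Fin k × m) ℂ), X.PosSemidef →
    (Matrix.of fun p q : Fin k × n =>
      Φ (Matrix.of fun a b : m => X (p.1, a) (q.1, b)) p.2 q.2).PosSemidef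

/-- A quantum instrument whose outcomes are natural numbers: a family of completely positive maps
whose sum is trace preserving. (Finitely many outcomes: all other maps are `0`. Since the maps are
completely positive and the dimensions finite, convergence of the traces is the same as convergence
of the sum of the maps.) -/
structure Instrument (m n : Type) [Fintype m] [Fintype n] where
  /-- the operation that takes place when the outcome is `r` -/
  op : ℕ → Matrix m m ℂ →ₗ[ℂ] Matrix n n ℂ
  completelyPositive : ∀ r, IsCompletelyPositive (op r)
  tracePreserving : ∀ X : Matrix m m ℂ, HasSum (fun r => (op r X).trace) X.trace

/-- The state of a system consisting of a qubit and a `d`-dimensional rest, after the unitary `U`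
is applied to the qubit: `(U ⊗ 1) ρ (U ⊗ 1)†`. -/
def applyGate {d : ℕ} (U : SU2) (ρ : Matrix (Fin 2 × Fin d) (Fin 2 × Fin d) ℂ) :
    Matrix (Fin 2 × Fin d) (Fin 2 × Fin d) ℂ :=
  ((U : Matrix (Fin 2) (Fin 2) ℂ) ⊗ₖ (1 : Matrix (Fin d) (Fin d) ℂ)) * ρ *
    ((U : Matrix (Fin 2) (Fin 2) ℂ) ⊗ₖ (1 : Matrix (Fin d) (Fin d) ℂ))ᴴ

/-! ### Discrimination protocols -/

/-- The three gates at the disposal of a protocol: one sample of each of the two candidates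
(labelled by `Fin 2`), and the target. -/
inductive Gate where
  | sample (i : Fin 2)
  | target

/-- A protocol that uses each of the three gates exactly once, in an order that may depend on the
outcomes obtained so far. The system always consists of a qubit, on which the next gate acts, and
a rest of finite dimension. -/
structure Protocol where
  /-- dimension of the rest of the system while the first gate is applied -/
  d₁ : ℕ
  /-- dimension of the rest of the system while the second gate is applied -/
  d₂ : ℕ
  /-- dimension of the rest of the system while the third gate is applied -/
  d₃ : ℕ
  /-- the initial state labelled `r₁`, multiplied by the probability of preparing it -/
  init : ℕ → Matrix (Fin 2 × Fin d₁) (Fin 2 × Fin d₁) ℂ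
  init_posSemidef : ∀ r₁, (init r₁).PosSemidef
  init_trace : HasSum (fun r₁ => (init r₁).trace) 1
  /-- the gate applied first, given `r₁` -/
  first : ℕ → Gate
  /-- the gate applied second, given `r₁` and `r₂` -/
  second : ℕ → ℕ → Gate
  /-- the gate applied last, given `r₁` and `r₂` -/
  third : ℕ → ℕ → Gate
  second_ne_first : ∀ r₁ r₂, second r₁ r₂ ≠ first r₁
  third_ne_first : ∀ r₁ r₂, third r₁ r₂ ≠ first r₁
  third_ne_second : ∀ r₁ r₂, third r₁ r₂ ≠ second r₁ r₂
  /-- the instrument, with outcome `r₂`, applied between the first and the second gate -/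
  inst₁ : ℕ → Instrument (Fin 2 × Fin d₁) (Fin 2 × Fin d₂)
  /-- the instrument, with outcome `r₃`, applied between the second and the third gate -/
  inst₂ : ℕ → ℕ → Instrument (Fin 2 × Fin d₂) (Fin 2 × Fin d₃)
  /-- the final measurement, with outcome the guessed candidate -/
  povm : ℕ → ℕ → ℕ → Fin 2 → Matrix (Fin 2 × Fin d₃) (Fin 2 × Fin d₃) ℂ
  povm_posSemidef : ∀ r₁ r₂ r₃ g, (povm r₁ r₂ r₃ g).PosSemidef
  povm_sum : ∀ r₁ r₂ r₃, ∑ g, povm r₁ r₂ r₃ g = 1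

namespace Protocol

/-- The unnormalized state of the system just before the final measurement, for given outcomes,
when the three gates implement the unitaries `V`. -/
def finalState (P : Protocol) (V : Gate → SU2) (r₁ r₂ r₃ : ℕ) :
    Matrix (Fin 2 × Fin P.d₃) (Fin 2 × Fin P.d₃) ℂ :=
  applyGate (V (P.third r₁ r₂)) <| (P.inst₂ r₁ r₂).op r₃ <|
    applyGate (V (P.second r₁ r₂)) <| (P.inst₁ r₁).op r₂ <|
      applyGate (V (P.first r₁)) <| P.init r₁

/-- The probability that the protocol guesses `g` when the three gates implement the
unitaries `V`. -/
def guessProb (P : Protocol) (V : Gate → SU2) (g : Fin 2) : ℝ≥0∞ :=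
  ∑' (r₁ : ℕ) (r₂ : ℕ) (r₃ : ℕ),
    ENNReal.ofReal (P.povm r₁ r₂ r₃ g * P.finalState V r₁ r₂ r₃).trace.re

/-- The unitaries implemented by the three gates when the candidates are `U 0` and `U 1` and the
target is the candidate `t`. -/
def gates (U : Fin 2 → SU2) (t : Fin 2) : Gate → SU2
  | .sample i => U i
  | .target => U t

/-- The probability of guessing correctly when the candidates are `U 0` and `U 1` and the target is
the candidate `t`. -/
def successProb (P : Protocol) (U : Fin 2 → SU2) (t : Fin 2) : ℝ≥0∞ :=
  P.guessProb (gates U t) t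

/-- The expected success probability: the candidates are independent and Haar distributed, and the
target is either of them with probability `1 / 2`. -/
def esp (P : Protocol) : ℝ≥0∞ :=
  (1 / 2) * ∑ t : Fin 2, ∫⁻ U₀, ∫⁻ U₁, P.successProb ![U₀, U₁] t ∂haarSU2 ∂haarSU2

/-- The protocol does not make use of the sample of candidate `i`: replacing the unitary
implemented by that sample by any other one never changes the probabilities of the guesses. -/
def IgnoresSample (P : Protocol) (i : Fin 2) : Prop :=
  ∀ V V' : Gate → SU2, (∀ a, a ≠ Gate.sample i → V a = V' a) →
    ∀ g, P.guessProb V g = P.guessProb V' g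

end Protocol

end GateDiscrimination

end

/-! With the other two gates fixed, a guess probability depends linearly on the map `ρ ↦ (W ⊗ 1) ρ
(W ⊗ 1)†` of the remaining gate `W`. The quaternion units `q` form a unitary 1-design: averaging
over `W = q * U` depolarizes the qubit, whatever `U` is. Hence the Haar average over `W` is the mean
of the four values at `q * U` (`lintegral_guessProb`), and so at least a quarter of the value at
`U`.

Upper bound (`esp_le`): when all three gates equal `U`, nothing reveals `t`, and the two guesses
have probabilities adding up to one. For `t = 0` only the sample of candidate `1` varies
independently of the other gates, so the mean probability of the wrong guess `1` is at least a
quarter of its mean at coinciding gates; likewise for `t = 1` and the wrong guess `0`. The two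
errors add up to at least `1/4`, so the average error is at least `1/8`.

Attainment: let sample `0` and the target act on the two halves of a singlet. The probability of
finding a singlet again is `|tr (U W⁻¹)|² / 4`, which is `1` for equal gates and `0` if they differ
by `i`, `j` or `k`. So the success probability is `1` for `t = 0` and `3/4` on average for `t = 1`,
with mean `7/8`. -/

noncomputable section

namespace GateDiscrimination

/-! ### Gates on one qubit and the quaternion twirl -/

section ApplyGate

variable {d : ℕ}

theorem applyGate_apply (U : SU2) (ρ : Matrix (Fin 2 × Fin d) (Fin 2 × Fin d) ℂ)
    (p q : Fin 2 × Fin d) :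
    applyGate U ρ p q = ∑ a, ∑ b, (U : Matrix (Fin 2) (Fin 2) ℂ) p.1 a * ρ (a, p.2) (b, q.2) *
      star ((U : Matrix (Fin 2) (Fin 2) ℂ) q.1 b) := by
  simp only [applyGate, Matrix.mul_apply, Fintype.sum_prod_type, Matrix.kroneckerMap_apply,
    Matrix.conjTranspose_apply, Matrix.one_apply, Finset.sum_mul]
  simp [apply_ite]
  ring

/-- `applyGate` as a linear map of the state. -/
def applyGateₗ (U : SU2) :
    Matrix (Fin 2 × Fin d) (Fin 2 × Fin d) ℂ →ₗ[ℂ] Matrix (Fin 2 × Fin d) (Fin 2 × Fin d) ℂ where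
  toFun := applyGate U
  map_add' X Y := by simp [applyGate, mul_add, add_mul]
  map_smul' c X := by simp [applyGate]

theorem applyGate_mul (U V : SU2) (ρ : Matrix (Fin 2 × Fin d) (Fin 2 × Fin d) ℂ) :
    applyGate (U * V) ρ = applyGate U (applyGate V ρ) := by
  have h : (((U * V : SU2) : Matrix (Fin 2) (Fin 2) ℂ) ⊗ₖ (1 : Matrix (Fin d) (Fin d) ℂ)) =
      ((U : Matrix (Fin 2) (Fin 2) ℂ) ⊗ₖ (1 : Matrix (Fin d) (Fin d) ℂ)) *
      ((V : Matrix (Fin 2) (Fin 2) ℂ) ⊗ₖ (1 : Matrix (Fin d) (Fin d) ℂ)) := by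
    rw [← Matrix.mul_kronecker_mul, one_mul]; rfl
  simp only [applyGate, h, Matrix.conjTranspose_mul, mul_assoc]

theorem applyGate_posSemidef (U : SU2) {ρ : Matrix (Fin 2 × Fin d) (Fin 2 × Fin d) ℂ}
    (h : ρ.PosSemidef) : (applyGate U ρ).PosSemidef :=
  h.mul_mul_conjTranspose_same _

theorem conjTranspose_mul_self_SU2 (U : SU2) :
    (U : Matrix (Fin 2) (Fin 2) ℂ)ᴴ * (U : Matrix (Fin 2) (Fin 2) ℂ) = 1 :=
  Matrix.mem_unitaryGroup_iff'.mp (Matrix.mem_specialUnitaryGroup_iff.mp U.2).1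

theorem trace_applyGate (U : SU2) (ρ : Matrix (Fin 2 × Fin d) (Fin 2 × Fin d) ℂ) :
    (applyGate U ρ).trace = ρ.trace := by
  rw [applyGate, Matrix.trace_mul_cycle, Matrix.conjTranspose_kronecker,
    ← Matrix.mul_kronecker_mul, conjTranspose_mul_self_SU2]
  simp

/-- The partial trace over the qubit is not affected by a gate on the qubit. -/
theorem sum_applyGate_apply (U : SU2) (ρ : Matrix (Fin 2 × Fin d) (Fin 2 × Fin d) ℂ)
    (i j : Fin d) : ∑ a, applyGate U ρ (a, i) (a, j) = ∑ a, ρ (a, i) (a, j) := by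
  have h := fun a b => congrFun (congrFun (conjTranspose_mul_self_SU2 U) a) b
  have h00 := h 0 0
  have h01 := h 0 1
  have h10 := h 1 0
  have h11 := h 1 1
  simp only [Matrix.mul_apply, Matrix.conjTranspose_apply, Fin.sum_univ_two, Matrix.one_apply,
    if_true, if_false, one_ne_zero, zero_ne_one] at h00 h01 h10 h11
  simp only [applyGate_apply, Fin.sum_univ_two]
  linear_combination ρ (0, i) (0, j) * h00 + ρ (1, i) (0, j) * h01 + ρ (0, i) (1, j) * h10 +
    ρ (1, i) (1, j) * h11

/-- The matrices of the unit quaternions `1, i, j, k`. -/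
def quaternionMatrix : Fin 4 → Matrix (Fin 2) (Fin 2) ℂ :=
  ![1, !![Complex.I, 0; 0, -Complex.I], !![0, 1; -1, 0], !![0, Complex.I; Complex.I, 0]]

/-- The unit quaternions `1, i, j, k` as elements of `SU(2)`. -/
def quaternionUnit (k : Fin 4) : SU2 :=
  ⟨quaternionMatrix k, by
    rw [Matrix.mem_specialUnitaryGroup_iff, Matrix.mem_unitaryGroup_iff]
    fin_cases k <;>
      simp [quaternionMatrix, Matrix.det_fin_two, Matrix.star_eq_conjTranspose, ← Matrix.ext_iff,
        Fin.forall_fin_two, Matrix.vecMul, dotProduct, Fin.sum_univ_two]⟩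

theorem quaternionUnit_zero : quaternionUnit 0 = 1 := rfl

/-- Averaging over the quaternion units completely depolarizes the qubit. -/
theorem sum_applyGate_quaternionUnit (ρ : Matrix (Fin 2 × Fin d) (Fin 2 × Fin d) ℂ) :
    ∑ k, applyGate (quaternionUnit k) ρ =
      Matrix.of fun p q => if p.1 = q.1 then 2 * ∑ a, ρ (a, p.2) (a, q.2) else 0 := by
  ext ⟨a, i⟩ ⟨b, j⟩
  rw [Matrix.sum_apply]
  simp only [applyGate_apply, Fin.sum_univ_four, Fin.sum_univ_two, quaternionUnit,
    quaternionMatrix, Matrix.of_apply]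
  fin_cases a <;> fin_cases b <;>
    simp [mul_right_comm Complex.I, Complex.I_mul_I] <;> ring

/-- The twirl keeps only the partial trace over the qubit, on which the earlier unitary has no
effect. -/
theorem sum_applyGate_quaternionUnit_mul (U V : SU2)
    (ρ : Matrix (Fin 2 × Fin d) (Fin 2 × Fin d) ℂ) :
    ∑ k, applyGate (quaternionUnit k * U) ρ = ∑ k, applyGate (quaternionUnit k * V) ρ := by
  simp only [applyGate_mul, sum_applyGate_quaternionUnit, sum_applyGate_apply]

theorem continuous_applyGate {X : Type*} [TopologicalSpace X] {U : X → SU2}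
    {ρ : X → Matrix (Fin 2 × Fin d) (Fin 2 × Fin d) ℂ} (hU : Continuous U) (hρ : Continuous ρ) :
    Continuous fun x => applyGate (U x) (ρ x) := by
  refine continuous_matrix fun p q => ?_
  simp only [applyGate_apply]
  have hU' : ∀ a b, Continuous fun x => (U x : Matrix (Fin 2) (Fin 2) ℂ) a b := fun a b =>
    (continuous_subtype_val.comp hU).matrix_elem a b
  exact continuous_finsetSum _ fun a _ => continuous_finsetSum _ fun b _ =>
    ((hU' _ _).mul (hρ.matrix_elem _ _)).mul (hU' _ _).star

end ApplyGate

/-! ### Positivity and measurability -/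

theorem IsCompletelyPositive.posSemidef_map {m n : Type} [Fintype m] [Fintype n]
    {Φ : Matrix m m ℂ →ₗ[ℂ] Matrix n n ℂ} (h : IsCompletelyPositive Φ) {X : Matrix m m ℂ}
    (hX : X.PosSemidef) : (Φ X).PosSemidef :=
  (h 1 (X.submatrix Prod.snd Prod.snd) (hX.submatrix _)).submatrix fun i => ((0 : Fin 1), i)

theorem posSemidef_trace_mul_nonneg {n : Type*} [Fintype n] {A B : Matrix n n ℂ}
    (hA : A.PosSemidef) (hB : B.PosSemidef) : 0 ≤ (A * B).trace := by
  classical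
  obtain ⟨C, rfl⟩ : ∃ C : Matrix n n ℂ, A = Cᴴ * C := by
    open scoped MatrixOrder in
    exact CStarAlgebra.nonneg_iff_eq_star_mul_self.mp hA.nonneg
  rw [mul_assoc, Matrix.trace_mul_comm]
  exact (hB.mul_mul_conjTranspose_same C).trace_nonneg

/-- A nonnegative complex series gives the corresponding series in `ℝ≥0∞`. -/
theorem tsum_ofReal_re {f : ℕ → ℂ} {s : ℂ} (hf : ∀ n, 0 ≤ f n) (h : HasSum f s) :
    ∑' n, ENNReal.ofReal (f n).re = ENNReal.ofReal s.re := by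
  have h' : HasSum (fun n => (f n).re) s.re := Complex.hasSum_re h
  rw [← h'.tsum_eq, ENNReal.ofReal_tsum_of_nonneg (fun n => (Complex.nonneg_iff.mp (hf n)).1)
    h'.summable]

/-- Needed so that open sets of `SU2 × SU2` are measurable for the product σ-algebra, and continuous
functions of both candidates are measurable. -/
instance : SecondCountableTopology SU2 :=
  haveI : SecondCountableTopology (Matrix (Fin 2) (Fin 2) ℂ) :=
    inferInstanceAs (SecondCountableTopology (Fin 2 → Fin 2 → ℂ))
  TopologicalSpace.Subtype.secondCountableTopology _

/-! ### Guess probabilities of a protocol -/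

namespace Protocol

theorem finalState_posSemidef (P : Protocol) (V : Gate → SU2) (r₁ r₂ r₃ : ℕ) :
    (P.finalState V r₁ r₂ r₃).PosSemidef :=
  applyGate_posSemidef _ <| ((P.inst₂ r₁ r₂).completelyPositive r₃).posSemidef_map <|
    applyGate_posSemidef _ <| ((P.inst₁ r₁).completelyPositive r₂).posSemidef_map <|
      applyGate_posSemidef _ <| P.init_posSemidef r₁

theorem trace_povm_mul_finalState_nonneg (P : Protocol) (V : Gate → SU2) (r₁ r₂ r₃ : ℕ)
    (g : Fin 2) : 0 ≤ (P.povm r₁ r₂ r₃ g * P.finalState V r₁ r₂ r₃).trace :=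
  posSemidef_trace_mul_nonneg (P.povm_posSemidef r₁ r₂ r₃ g) (P.finalState_posSemidef V r₁ r₂ r₃)

/-- The probabilities of the two guesses add up to one. -/
theorem sum_guessProb (P : Protocol) (V : Gate → SU2) : ∑ g, P.guessProb V g = 1 := by
  have hpos := P.finalState_posSemidef V
  have h₀ : ∀ r₁ r₂ r₃, ∑ g, ENNReal.ofReal (P.povm r₁ r₂ r₃ g *
      P.finalState V r₁ r₂ r₃).trace.re = ENNReal.ofReal (P.finalState V r₁ r₂ r₃).trace.re := by
    intro r₁ r₂ r₃
    rw [← ENNReal.ofReal_sum_of_nonneg fun g _ =>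
      (Complex.nonneg_iff.mp (P.trace_povm_mul_finalState_nonneg V r₁ r₂ r₃ g)).1,
      ← Complex.re_sum, ← Matrix.trace_sum, ← Finset.sum_mul, P.povm_sum, one_mul]
  have hinit : ∀ r₁, (applyGate (V (P.first r₁)) (P.init r₁)).PosSemidef := fun r₁ =>
    applyGate_posSemidef _ (P.init_posSemidef r₁)
  have hmid : ∀ r₁ r₂, (applyGate (V (P.second r₁ r₂)) <| (P.inst₁ r₁).op r₂ <|
      applyGate (V (P.first r₁)) <| P.init r₁).PosSemidef := fun r₁ r₂ =>
    applyGate_posSemidef _ <| ((P.inst₁ r₁).completelyPositive r₂).posSemidef_map (hinit r₁)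
  simp only [guessProb]
  rw [← Summable.tsum_finsetSum fun _ _ => ENNReal.summable]
  simp only [← Summable.tsum_finsetSum fun _ _ => ENNReal.summable, h₀]
  -- The series are summed from the innermost outwards; trace preservation removes one instrument at
  -- a time.
  have h₃ : ∀ r₁ r₂, ∑' r₃, ENNReal.ofReal (P.finalState V r₁ r₂ r₃).trace.re =
      ENNReal.ofReal (((P.inst₁ r₁).op r₂) (applyGate (V (P.first r₁)) (P.init r₁))).trace.re := by
    intro r₁ r₂
    rw [tsum_ofReal_re (fun r₃ => (hpos r₁ r₂ r₃).trace_nonneg)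
      (s := ((P.inst₁ r₁).op r₂ (applyGate (V (P.first r₁)) (P.init r₁))).trace)]
    rw [← trace_applyGate (V (P.second r₁ r₂))]
    simpa only [finalState, trace_applyGate] using (P.inst₂ r₁ r₂).tracePreserving
      (applyGate (V (P.second r₁ r₂)) ((P.inst₁ r₁).op r₂
        (applyGate (V (P.first r₁)) (P.init r₁))))
  have h₂ : ∀ r₁, ∑' r₂, ENNReal.ofReal
      (((P.inst₁ r₁).op r₂) (applyGate (V (P.first r₁)) (P.init r₁))).trace.re =
      ENNReal.ofReal (P.init r₁).trace.re := by
    intro r₁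
    rw [tsum_ofReal_re (fun r₂ => (((P.inst₁ r₁).completelyPositive r₂).posSemidef_map
      (hinit r₁)).trace_nonneg) ((P.inst₁ r₁).tracePreserving _), trace_applyGate]
  simp only [h₃, h₂]
  rw [tsum_ofReal_re (fun r₁ => (P.init_posSemidef r₁).trace_nonneg) P.init_trace]
  simp

theorem guessProb_zero_add_one (P : Protocol) (V : Gate → SU2) :
    P.guessProb V 0 + P.guessProb V 1 = 1 := by
  rw [← P.sum_guessProb V, Fin.sum_univ_two]

theorem continuous_finalState (P : Protocol) {X : Type*} [TopologicalSpace X]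
    {V : X → Gate → SU2} (hV : ∀ a, Continuous fun x => V x a) (r₁ r₂ r₃ : ℕ) :
    Continuous fun x => P.finalState (V x) r₁ r₂ r₃ :=
  continuous_applyGate (hV _) <| ((P.inst₂ r₁ r₂).op r₃).continuous_of_finiteDimensional.comp <|
    continuous_applyGate (hV _) <| ((P.inst₁ r₁).op r₂).continuous_of_finiteDimensional.comp <|
      continuous_applyGate (hV _) continuous_const

theorem measurable_guessProb (P : Protocol) {X : Type*} [TopologicalSpace X] [MeasurableSpace X]
    [OpensMeasurableSpace X] {V : X → Gate → SU2} (hV : ∀ a, Continuous fun x => V x a)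
    (g : Fin 2) : Measurable fun x => P.guessProb (V x) g := by
  refine Measurable.tsum fun r₁ => Measurable.tsum fun r₂ =>
    Measurable.tsum fun r₃ => Continuous.measurable ?_
  exact ENNReal.continuous_ofReal.comp <| Complex.continuous_re.comp <|
    (continuous_const.matrix_mul (P.continuous_finalState hV r₁ r₂ r₃)).matrix_trace

/-- Every gate is one of the three gates used by the protocol. -/
theorem gate_cases (P : Protocol) (r₁ r₂ : ℕ) (a : Gate) :
    a = P.first r₁ ∨ a = P.second r₁ r₂ ∨ a = P.third r₁ r₂ := by
  have h₁ := P.second_ne_first r₁ r₂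
  have h₂ := P.third_ne_first r₁ r₂
  have h₃ := P.third_ne_second r₁ r₂
  generalize P.first r₁ = x at *
  generalize P.second r₁ r₂ = y at *
  generalize P.third r₁ r₂ = z at *
  -- Three distinct elements exhaust the three-element type `Gate`.
  rcases a with i | _ <;> rcases x with x | _ <;> rcases y with y | _ <;> rcases z with z | _ <;>
    simp only [ne_eq, Gate.sample.injEq, reduceCtorEq, not_true_eq_false, not_false_eq_true,
      or_true, or_false, false_or] at * <;>
    omega

/-! ### Averaging over a single gate -/

/-- The averaged final state does not depend on the gate that is averaged over the quaternion
units. -/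
theorem sum_finalState_quaternionUnit_mul (P : Protocol) {V : SU2 → Gate → SU2} {a : Gate}
    (hV : ∀ W, V W a = W) (hV' : ∀ W W' b, b ≠ a → V W b = V W' b) (W U : SU2) (r₁ r₂ r₃ : ℕ) :
    ∑ k, P.finalState (V (quaternionUnit k * W)) r₁ r₂ r₃ =
      ∑ k, P.finalState (V (quaternionUnit k * U)) r₁ r₂ r₃ := by
  have h₁ := P.second_ne_first r₁ r₂
  have h₂ := P.third_ne_first r₁ r₂
  have h₃ := P.third_ne_second r₁ r₂
  -- The linear form lets `map_sum` move the sum through the later operations, down to the gate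
  -- being averaged.
  have key : ∀ {d : ℕ} (b : Gate) (ρ : Matrix (Fin 2 × Fin d) (Fin 2 × Fin d) ℂ) (W' : SU2),
      applyGateₗ (V W' b) ρ = applyGate (V W' b) ρ := fun _ _ _ => rfl
  rcases P.gate_cases r₁ r₂ a with h | h | h
  · subst h
    have e₂ := fun X => hV' X 1 _ h₁
    have e₃ := fun X => hV' X 1 _ h₂
    simp only [finalState, hV, e₂, e₃]
    simp only [← key, ← map_sum, sum_applyGate_quaternionUnit_mul W U]
  · subst h
    have e₁ := fun X => hV' X 1 _ h₁.symm
    have e₃ := fun X => hV' X 1 _ h₃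
    simp only [finalState, hV, e₁, e₃]
    simp only [← key, ← map_sum]
    simp only [key, sum_applyGate_quaternionUnit_mul W U]
  · subst h
    have e₁ := fun X => hV' X 1 _ h₂.symm
    have e₂ := fun X => hV' X 1 _ h₃.symm
    simp only [finalState, hV, e₁, e₂, sum_applyGate_quaternionUnit_mul W U]

theorem sum_guessProb_quaternionUnit_mul (P : Protocol) {V : SU2 → Gate → SU2} {a : Gate}
    (hV : ∀ W, V W a = W) (hV' : ∀ W W' b, b ≠ a → V W b = V W' b) (g : Fin 2) (W U : SU2) :
    ∑ k, P.guessProb (V (quaternionUnit k * W)) g =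
      ∑ k, P.guessProb (V (quaternionUnit k * U)) g := by
  simp only [guessProb]
  simp only [← Summable.tsum_finsetSum fun _ _ => ENNReal.summable]
  refine tsum_congr fun r₁ => tsum_congr fun r₂ => tsum_congr fun r₃ => ?_
  simp only [← ENNReal.ofReal_sum_of_nonneg fun k _ =>
    (Complex.nonneg_iff.mp (P.trace_povm_mul_finalState_nonneg (V (quaternionUnit k * _))
      r₁ r₂ r₃ g)).1]
  simp only [← Complex.re_sum, ← Matrix.trace_sum, ← Finset.mul_sum,
    P.sum_finalState_quaternionUnit_mul hV hV' W U]

/-- The Haar average over one gate is the average over the quaternion units. -/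
theorem lintegral_guessProb (P : Protocol) {V : SU2 → Gate → SU2} {a : Gate}
    (hV : ∀ W, V W a = W) (hV' : ∀ W W' b, b ≠ a → V W b = V W' b) (g : Fin 2) (U : SU2) :
    4 * ∫⁻ W, P.guessProb (V W) g ∂haarSU2 =
      ∑ k, P.guessProb (V (quaternionUnit k * U)) g := by
  have hc : ∀ b, Continuous fun W => V W b := by
    intro b
    by_cases hb : b = a
    · subst hb; simpa only [hV] using continuous_id'
    · simpa only [fun W => hV' W 1 b hb] using continuous_const
  have hm : ∀ k, Measurable fun W => P.guessProb (V (quaternionUnit k * W)) g := fun k =>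
    P.measurable_guessProb (fun b => (hc b).comp (continuous_const.mul continuous_id)) g
  calc 4 * ∫⁻ W, P.guessProb (V W) g ∂haarSU2
      = ∑ k : Fin 4, ∫⁻ W, P.guessProb (V (quaternionUnit k * W)) g ∂haarSU2 := by
        -- By left invariance of the Haar measure, each of the four integrals equals the original
        -- one.
        simp only [lintegral_mul_left_eq_self fun W => P.guessProb (V W) g]
        simp
    _ = ∫⁻ W, ∑ k : Fin 4, P.guessProb (V (quaternionUnit k * W)) g ∂haarSU2 :=
        (lintegral_finsetSum _ fun k _ => hm k).symm
    _ = _ := by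
        -- The integrand is constant in `W`, and the measure has mass one.
        simp only [P.sum_guessProb_quaternionUnit_mul hV hV' g _ U]
        simp

/-- Of the four nonnegative terms at `q * U`, only the one with `q = 1` is kept. -/
theorem guessProb_le_lintegral (P : Protocol) {V : SU2 → Gate → SU2} {a : Gate}
    (hV : ∀ W, V W a = W) (hV' : ∀ W W' b, b ≠ a → V W b = V W' b) (g : Fin 2) (U : SU2) :
    P.guessProb (V U) g ≤ 4 * ∫⁻ W, P.guessProb (V W) g ∂haarSU2 := by
  rw [P.lintegral_guessProb hV hV' g U]
  simpa [quaternionUnit_zero] using Finset.single_le_sum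
    (f := fun k => P.guessProb (V (quaternionUnit k * U)) g) (fun _ _ => zero_le)
    (Finset.mem_univ 0)

/-! ### The upper bound -/

/-- The probability of guessing `g` when all three gates implement the same unitary. -/
def constGuessProb (P : Protocol) (g : Fin 2) (U : SU2) : ℝ≥0∞ := P.guessProb (fun _ => U) g

theorem gates_diag (U : SU2) (t : Fin 2) : gates ![U, U] t = fun _ => U := by
  funext a
  rcases a with i | _
  · fin_cases i <;> rfl
  · fin_cases t <;> rfl

theorem continuous_gates {X : Type*} [TopologicalSpace X] {f₀ f₁ : X → SU2}
    (h₀ : Continuous f₀) (h₁ : Continuous f₁) (t : Fin 2) (a : Gate) :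
    Continuous fun x => gates ![f₀ x, f₁ x] t a := by
  rcases a with i | _
  · fin_cases i <;> simpa [gates]
  · fin_cases t <;> simpa [gates]

/-- For target `0`, sample `1` is the only gate implementing `W`, so the one-gate bound applies; at
`W = U` all gates coincide. -/
theorem lintegral_wrongGuess_zero (P : Protocol) (U : SU2) :
    P.constGuessProb 1 U ≤ 4 * ∫⁻ W, P.guessProb (gates ![U, W] 0) 1 ∂haarSU2 := by
  have := P.guessProb_le_lintegral (V := fun W => gates ![U, W] 0) (a := .sample 1)
    (fun _ => rfl) (fun W W' b hb => by
      rcases b with i | _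
      · fin_cases i
        · rfl
        · exact absurd rfl hb
      · rfl) 1 U
  rwa [gates_diag] at this

theorem lintegral_wrongGuess_one (P : Protocol) (U : SU2) :
    P.constGuessProb 0 U ≤ 4 * ∫⁻ W, P.guessProb (gates ![W, U] 1) 0 ∂haarSU2 := by
  have := P.guessProb_le_lintegral (V := fun W => gates ![W, U] 1) (a := .sample 0)
    (fun _ => rfl) (fun W W' b hb => by
      rcases b with i | _
      · fin_cases i
        · exact absurd rfl hb
        · rfl
      · rfl) 0 U
  rwa [gates_diag] at this

theorem lintegral_lintegral_add_guessProb (P : Protocol) (t : Fin 2) :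
    (∫⁻ U₀, ∫⁻ U₁, P.guessProb (gates ![U₀, U₁] t) 0 ∂haarSU2 ∂haarSU2) +
      ∫⁻ U₀, ∫⁻ U₁, P.guessProb (gates ![U₀, U₁] t) 1 ∂haarSU2 ∂haarSU2 = 1 := by
  have hm : Measurable fun U : SU2 × SU2 => P.guessProb (gates ![U.1, U.2] t) 0 :=
    P.measurable_guessProb (continuous_gates continuous_fst continuous_snd t) 0
  rw [← lintegral_add_left hm.lintegral_prod_right']
  have : ∀ U₀, (∫⁻ U₁, P.guessProb (gates ![U₀, U₁] t) 0 ∂haarSU2) +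
      ∫⁻ U₁, P.guessProb (gates ![U₀, U₁] t) 1 ∂haarSU2 = 1 := fun U₀ => by
    have hm' : Measurable fun U₁ => P.guessProb (gates ![U₀, U₁] t) 0 :=
      P.measurable_guessProb (continuous_gates continuous_const continuous_id t) 0
    rw [← lintegral_add_left hm']
    simp [guessProb_zero_add_one]
  simp [this]

theorem esp_le (P : Protocol) : P.esp ≤ 7 / 8 := by
  have hdiag : Measurable (P.constGuessProb 0) :=
    P.measurable_guessProb (fun _ => continuous_id) 0
  have hsum : (∫⁻ U, P.constGuessProb 0 U ∂haarSU2) + ∫⁻ U, P.constGuessProb 1 U ∂haarSU2 = 1 := by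
    rw [← lintegral_add_left hdiag]
    simp [constGuessProb, guessProb_zero_add_one]
  have h₀ : ∫⁻ U, P.constGuessProb 1 U ∂haarSU2 ≤
      4 * ∫⁻ U₀, ∫⁻ U₁, P.guessProb (gates ![U₀, U₁] 0) 1 ∂haarSU2 ∂haarSU2 := by
    rw [← lintegral_const_mul' _ _ (by simp)]
    exact lintegral_mono P.lintegral_wrongGuess_zero
  have h₁ : ∫⁻ U, P.constGuessProb 0 U ∂haarSU2 ≤
      4 * ∫⁻ U₀, ∫⁻ U₁, P.guessProb (gates ![U₀, U₁] 1) 0 ∂haarSU2 ∂haarSU2 := by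
    -- For target `1` the independent gate is sample `0`, so the integral over `U₀` must be the
    -- inner one.
    rw [lintegral_lintegral_swap (P.measurable_guessProb
      (continuous_gates continuous_fst continuous_snd 1) 0).aemeasurable,
      ← lintegral_const_mul' _ _ (by simp)]
    exact lintegral_mono P.lintegral_wrongGuess_one
  have e₀ := P.lintegral_lintegral_add_guessProb 0
  have e₁ := P.lintegral_lintegral_add_guessProb 1
  simp only [esp, successProb, Fin.sum_univ_two]
  generalize (∫⁻ U₀, ∫⁻ U₁, P.guessProb (gates ![U₀, U₁] 0) 0 ∂haarSU2 ∂haarSU2) = a₀ at *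
  generalize (∫⁻ U₀, ∫⁻ U₁, P.guessProb (gates ![U₀, U₁] 0) 1 ∂haarSU2 ∂haarSU2) = b₀ at *
  generalize (∫⁻ U₀, ∫⁻ U₁, P.guessProb (gates ![U₀, U₁] 1) 0 ∂haarSU2 ∂haarSU2) = b₁ at *
  generalize (∫⁻ U₀, ∫⁻ U₁, P.guessProb (gates ![U₀, U₁] 1) 1 ∂haarSU2 ∂haarSU2) = a₁ at *
  have h : 1 ≤ 4 * (b₀ + b₁) := by
    rw [← hsum, mul_add, add_comm]
    exact add_le_add h₀ h₁
  have hb : 8⁻¹ ≤ 2⁻¹ * (b₀ + b₁) := by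
    calc (8⁻¹ : ℝ≥0∞) = 8⁻¹ * 1 := by simp
      _ ≤ 8⁻¹ * (4 * (b₀ + b₁)) := by gcongr
      _ = 2⁻¹ * (b₀ + b₁) := by
        rw [← mul_assoc]; congr 1
        rw [← ENNReal.toReal_eq_toReal_iff' (by finiteness) (by finiteness)]; norm_num
  have htot : 2⁻¹ * (a₀ + a₁) + 2⁻¹ * (b₀ + b₁) = 1 := by
    rw [← mul_add, show a₀ + a₁ + (b₀ + b₁) = (a₀ + b₀) + (b₁ + a₁) by ring, e₀, e₁,
      one_add_one_eq_two, ENNReal.inv_mul_cancel (by simp) (by simp)]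
  have h78 : (7 / 8 : ℝ≥0∞) + 8⁻¹ = 1 := by
    rw [← ENNReal.toReal_eq_toReal_iff' (by finiteness) (by finiteness),
      ENNReal.toReal_add (by finiteness) (by finiteness)]
    norm_num
  rw [one_div]
  -- Adding `1/8` to both sides avoids truncated subtraction in `ℝ≥0∞`.
  refine (ENNReal.add_le_add_iff_right (a := 8⁻¹) (by simp)).mp ?_
  rw [h78, ← htot]
  gcongr

end Protocol

/-! ### A protocol that uses one sample only -/

/-- The instrument with the single outcome `0` given by a completely positive trace-preserving
map. -/
def Instrument.ofChannel {m n : Type} [Fintype m] [Fintype n]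
    (Φ : Matrix m m ℂ →ₗ[ℂ] Matrix n n ℂ) (hΦ : IsCompletelyPositive Φ)
    (htr : ∀ X, (Φ X).trace = X.trace) : Instrument m n where
  op r := if r = 0 then Φ else 0
  completelyPositive r := by
    split_ifs
    · exact hΦ
    · intro k X _
      exact Matrix.PosSemidef.zero
  tracePreserving X := by
    rw [← htr X]
    convert hasSum_ite_eq (0 : ℕ) (Φ X).trace using 2 with r
    split_ifs <;> simp

/-- The channel that discards the input and prepares the state `σ`. -/
def replaceChannel {m n : Type} [Fintype m] (σ : Matrix n n ℂ) :
    Matrix m m ℂ →ₗ[ℂ] Matrix n n ℂ :=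
  (Matrix.traceLinearMap m ℂ ℂ).smulRight σ

theorem replaceChannel_apply {m n : Type} [Fintype m] (σ : Matrix n n ℂ) (X : Matrix m m ℂ) :
    replaceChannel σ X = X.trace • σ := rfl

/-- Applied to one part of `X`, the channel gives the Kronecker product of a partial trace of `X`
with `σ`, both positive semidefinite. -/
theorem isCompletelyPositive_replaceChannel {m n : Type} [Fintype m] [Fintype n]
    {σ : Matrix n n ℂ} (hσ : σ.PosSemidef) :
    IsCompletelyPositive (replaceChannel (m := m) σ) := by
  intro k X hX
  have h : (∑ a : m, X.submatrix (fun i => (i, a)) fun i => (i, a)).PosSemidef :=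
    Matrix.posSemidef_sum _ fun a _ => hX.submatrix _
  have e : (Matrix.of fun p q : Fin k × n => replaceChannel σ
      (Matrix.of fun a b : m => X (p.1, a) (q.1, b)) p.2 q.2) =
      (∑ a : m, X.submatrix (fun i => (i, a)) fun i => (i, a)) ⊗ₖ σ := by
    ext p q
    simp [replaceChannel_apply, Matrix.trace, Matrix.sum_apply]
  rw [e]
  exact h.kronecker hσ

/-- The channel that exchanges two systems. -/
def swapChannel (m n : Type) : Matrix (m × n) (m × n) ℂ →ₗ[ℂ] Matrix (n × m) (n × m) ℂ where
  toFun X := X.submatrix Prod.swap Prod.swap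
  map_add' _ _ := rfl
  map_smul' _ _ := rfl

theorem swapChannel_apply {m n : Type} (X : Matrix (m × n) (m × n) ℂ) (p q : n × m) :
    swapChannel m n X p q = X p.swap q.swap := rfl

theorem isCompletelyPositive_swapChannel (m n : Type) [Fintype m] [Fintype n] :
    IsCompletelyPositive (swapChannel m n) := fun k _ hX =>
  hX.submatrix fun p : Fin k × (n × m) => (p.1, p.2.swap)

theorem trace_swapChannel {m n : Type} [Fintype m] [Fintype n] (X : Matrix (m × n) (m × n) ℂ) :
    (swapChannel m n X).trace = X.trace :=
  (Equiv.prodComm n m).sum_comp fun p => X p p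

/-- The singlet vector of two qubits, not normalized. -/
def singletVec (p : Fin 2 × Fin 2) : ℂ := !![0, 1; -1, 0] p.1 p.2

/-- The projector onto the singlet state of two qubits. -/
def singlet : Matrix (Fin 2 × Fin 2) (Fin 2 × Fin 2) ℂ :=
  (1 / 2 : ℂ) • Matrix.vecMulVec singletVec (star singletVec)

theorem singlet_posSemidef : singlet.PosSemidef :=
  (Matrix.posSemidef_vecMulVec_self_star _).smul (by positivity)

theorem trace_singlet : singlet.trace = 1 := by
  simp [singlet, singletVec, Matrix.trace, Matrix.vecMulVec_apply, Fintype.sum_prod_type]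
  norm_num

theorem singlet_mul_self : singlet * singlet = singlet := by
  have h : star singletVec ⬝ᵥ singletVec = 2 := by
    simp [singletVec, dotProduct, Fintype.sum_prod_type]
    norm_num
  rw [singlet, Matrix.smul_mul, Matrix.mul_smul, Matrix.vecMulVec_mul_vecMulVec, h]
  simp [Matrix.vecMulVec_smul, smul_smul]

/-- The complement of an orthogonal projection is again one, hence of the form `Bᴴ * B`. -/
theorem one_sub_singlet_posSemidef : (1 - singlet).PosSemidef := by
  have h : (1 - singlet)ᴴ * (1 - singlet) = 1 - singlet := by
    rw [Matrix.conjTranspose_sub, singlet_posSemidef.isHermitian.eq]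
    simp [mul_sub, sub_mul, singlet_mul_self]
  rw [← h]
  exact Matrix.posSemidef_conjTranspose_mul_self _

/-- The overlap with the singlet when `U` and `W` act on the two qubits of a singlet. -/
theorem trace_singlet_mul_applyGate (U W : SU2) :
    (singlet * applyGate U (swapChannel _ _ (applyGate W singlet))).trace =
      (Complex.normSq (U.1 0 0 * W.1 1 1 + U.1 1 1 * W.1 0 0 - U.1 0 1 * W.1 1 0 -
        U.1 1 0 * W.1 0 1) / 4 : ℝ) := by
  rw [Complex.ofReal_div, Complex.normSq_eq_conj_mul_self]
  simp [Matrix.trace, Matrix.mul_apply, Fintype.sum_prod_type, applyGate_apply,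
    swapChannel_apply, singlet, singletVec, Matrix.vecMulVec_apply]
  ring

/-- The protocol that applies sample `0` and the target to the two qubits of a singlet, and guesses
candidate `0` if the result is a singlet. Sample `1` is applied to a state that is discarded. -/
def singletProtocol : Protocol where
  d₁ := 1
  d₂ := 2
  d₃ := 2
  init r₁ := if r₁ = 0 then (1 / 2 : ℂ) • 1 else 0
  init_posSemidef r₁ := by
    split_ifs
    · exact Matrix.PosSemidef.one.smul (by positivity)
    · exact Matrix.PosSemidef.zero
  init_trace := by
    convert hasSum_ite_eq (0 : ℕ) (1 : ℂ) using 2 with r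
    split_ifs <;> simp
  first _ := .sample 1
  second _ _ := .sample 0
  third _ _ := .target
  second_ne_first := by simp
  third_ne_first := by simp
  third_ne_second := by simp
  inst₁ _ := .ofChannel (replaceChannel singlet)
    (isCompletelyPositive_replaceChannel singlet_posSemidef)
    fun X => by simp [replaceChannel_apply, trace_singlet]
  inst₂ _ _ := .ofChannel (swapChannel _ _) (isCompletelyPositive_swapChannel _ _)
    trace_swapChannel
  povm _ _ _ := ![singlet, 1 - singlet]
  povm_posSemidef _ _ _ g := by
    fin_cases g
    · exact singlet_posSemidef
    · exact one_sub_singlet_posSemidef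
  povm_sum := by simp

namespace Protocol

theorem finalState_singletProtocol (V : Gate → SU2) (r₁ r₂ r₃ : ℕ) :
    singletProtocol.finalState V r₁ r₂ r₃ =
      if r₁ = 0 ∧ r₂ = 0 ∧ r₃ = 0 then applyGate (V .target)
        (swapChannel _ _ (applyGate (V (.sample 0)) singlet)) else 0 := by
  have hzero : ∀ {d : ℕ} (U : SU2),
      applyGate U (0 : Matrix (Fin 2 × Fin d) (Fin 2 × Fin d) ℂ) = 0 :=
    fun U => (applyGateₗ U).map_zero
  change applyGate (d := 2) _ ((if r₃ = 0 then swapChannel (Fin 2) (Fin 2) else 0)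
    (applyGate (d := 2) _ ((if r₂ = 0 then replaceChannel singlet else 0)
      (applyGate (d := 1) (V (.sample 1)) (if r₁ = 0 then (1 / 2 : ℂ) • 1 else 0))))) = _
  by_cases h₁ : r₁ = 0 <;> by_cases h₂ : r₂ = 0 <;> by_cases h₃ : r₃ = 0 <;>
    (simp [h₁, h₂, h₃, hzero, replaceChannel_apply, trace_applyGate]; try rfl)

theorem guessProb_singletProtocol (V : Gate → SU2) (g : Fin 2) :
    singletProtocol.guessProb V g =
      ENNReal.ofReal ((![singlet, 1 - singlet] g * applyGate (V .target)
        (swapChannel _ _ (applyGate (V (.sample 0)) singlet))).trace.re) := by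
  have h : ∀ r₁ r₂ r₃, (singletProtocol.povm r₁ r₂ r₃ g *
      singletProtocol.finalState V r₁ r₂ r₃).trace =
      if r₁ = 0 ∧ r₂ = 0 ∧ r₃ = 0 then (![singlet, 1 - singlet] g * applyGate (V .target)
        (swapChannel _ _ (applyGate (V (.sample 0)) singlet))).trace else 0 := by
    intro r₁ r₂ r₃
    rw [finalState_singletProtocol]
    split_ifs
    · rfl
    · exact (congrArg Matrix.trace (Matrix.mul_zero _)).trans (Matrix.trace_zero _ _)
  simp only [guessProb, h]
  rw [tsum_eq_single 0, tsum_eq_single 0, tsum_eq_single 0, if_pos ⟨rfl, rfl, rfl⟩]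
  all_goals
    intro r hr
    simp [hr]

theorem singletProtocol_ignoresSample : singletProtocol.IgnoresSample 1 := by
  intro V V' h g
  rw [guessProb_singletProtocol, guessProb_singletProtocol, h .target (by simp),
    h (.sample 0) (by simp)]

theorem guessProb_zero_singletProtocol (V : Gate → SU2) :
    singletProtocol.guessProb V 0 = ENNReal.ofReal (Complex.normSq
      ((V .target).1 0 0 * (V (.sample 0)).1 1 1 + (V .target).1 1 1 * (V (.sample 0)).1 0 0 -
        (V .target).1 0 1 * (V (.sample 0)).1 1 0 -
        (V .target).1 1 0 * (V (.sample 0)).1 0 1) / 4) := by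
  rw [guessProb_singletProtocol, Matrix.cons_val_zero, trace_singlet_mul_applyGate,
    Complex.ofReal_re]

theorem successProb_singletProtocol_zero (U : Fin 2 → SU2) :
    singletProtocol.successProb U 0 = 1 := by
  have hdet : (U 0).1 0 0 * (U 0).1 1 1 - (U 0).1 0 1 * (U 0).1 1 0 = 1 := by
    rw [← Matrix.det_fin_two]
    exact (Matrix.mem_specialUnitaryGroup_iff.mp (U 0).2).2
  rw [successProb, guessProb_zero_singletProtocol]
  simp only [gates]
  -- For equal gates the amplitude is twice the determinant, and `|2|² / 4 = 1`.
  rw [show ∀ a b c e : ℂ, a * e + e * a - b * c - c * b = 2 * (a * e - b * c) from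
    fun a b c e => by ring, hdet]
  norm_num

/-- The amplitude is `tr (T * adj U)` with `T = q * U`, that is `det U * tr q`, and `i`, `j`, `k`
are traceless. -/
theorem successProb_singletProtocol_one (U : SU2) {k : Fin 4} (hk : k ≠ 0) :
    singletProtocol.successProb ![U, quaternionUnit k * U] 1 = 1 := by
  have h : singletProtocol.guessProb (gates ![U, quaternionUnit k * U] 1) 0 = 0 := by
    rw [guessProb_zero_singletProtocol]
    fin_cases k
    · exact absurd rfl hk
    all_goals
      rw [ENNReal.ofReal_eq_zero]
      refine le_of_eq ?_
      rw [div_eq_zero_iff, Complex.normSq_eq_zero]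
      left
      simp [gates, quaternionUnit, quaternionMatrix, Matrix.mul_apply]
      ring
  simpa [successProb, h] using
    singletProtocol.guessProb_zero_add_one (gates ![U, quaternionUnit k * U] 1)

theorem three_le_lintegral_successProb (U : SU2) :
    3 ≤ 4 * ∫⁻ W, singletProtocol.successProb ![U, W] 1 ∂haarSU2 := by
  -- Sample `1` is ignored, so that only the target varies.
  let V : SU2 → Gate → SU2 := fun W a => match a with
    | .sample _ => U
    | .target => W
  have hV : ∀ W, singletProtocol.successProb ![U, W] 1 = singletProtocol.guessProb (V W) 1 :=
    fun W => singletProtocol_ignoresSample _ _ (fun a ha => by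
      rcases a with i | _
      · fin_cases i
        · rfl
        · exact absurd rfl ha
      · rfl) 1
  simp only [hV]
  rw [singletProtocol.lintegral_guessProb (V := V) (a := .target) (fun _ => rfl)
    (fun W W' b hb => by
      rcases b with i | _
      · rfl
      · exact absurd rfl hb) 1 U]
  -- The three nontrivial units contribute `1` each; the term of `q = 1` is only bounded below by
  -- `0`.
  simp only [← hV, Fin.sum_univ_succ (n := 3),
    successProb_singletProtocol_one U (Fin.succ_ne_zero _)]
  simp

theorem le_esp_singletProtocol : 7 / 8 ≤ singletProtocol.esp := by
  have h := lintegral_mono (μ := haarSU2) three_le_lintegral_successProb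
  rw [lintegral_const_mul' _ _ (by simp)] at h
  simp only [esp, Fin.sum_univ_two, successProb_singletProtocol_zero]
  generalize (∫⁻ U₀, ∫⁻ U₁, singletProtocol.successProb ![U₀, U₁] 1 ∂haarSU2 ∂haarSU2) = a at *
  simp only [lintegral_const, measure_univ, mul_one] at h ⊢
  calc (7 / 8 : ℝ≥0∞) = 1 / 2 * (1 + 4⁻¹ * 3) := by
        rw [← ENNReal.toReal_eq_toReal_iff' (by finiteness) (by finiteness), ENNReal.toReal_mul,
          ENNReal.toReal_add (by finiteness) (by finiteness)]
        norm_num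
    _ ≤ 1 / 2 * (1 + 4⁻¹ * (4 * a)) := by gcongr
    _ = 1 / 2 * (1 + a) := by
        rw [← mul_assoc, ENNReal.inv_mul_cancel (by simp) (by simp), one_mul]

end Protocol

end GateDiscrimination

end

/-- The optimal expected success probability is `7 / 8`, and it is attained by a protocol that
ignores one of the two samples. -/
theorem theorem1 :
    IsGreatest (Set.range GateDiscrimination.Protocol.esp) (7 / 8) ∧
      ∃ (P : GateDiscrimination.Protocol) (i : Fin 2), P.esp = 7 / 8 ∧ P.IgnoresSample i := by
  have h : GateDiscrimination.singletProtocol.esp = 7 / 8 :=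
    le_antisymm (GateDiscrimination.Protocol.esp_le _)
      GateDiscrimination.Protocol.le_esp_singletProtocol
  refine ⟨⟨⟨_, h⟩, ?_⟩, _, 1, h, GateDiscrimination.Protocol.singletProtocol_ignoresSample⟩
  rintro _ ⟨P, rfl⟩
  exact P.esp_le
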